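/- Let $P=\{0,\dots,p-1\}$. The Sierpiński graph $S_p^n$ has vertex set $P^n$ (words of length $n$ over $P$) and edges $\{\underline{s}ij^{d-1},\underline{s}ji^{d-1}\}$ for $1\le d\le n$, $\underline{s}\in P^{n-d}$ and distinct $i,j\in P$. The generalized Sierpiński triangle graph $\hat S_p^n$ is the simple graph obtained from $S_p^{n+1}$ by contracting all non-clique edges, that is, all edges $\{\underline{s}ij^{l},\underline{s}ji^{l}\}$ with $1\le l\le n$, $\underline{s}\in P^{n-l}$ and distinct $i,j\in P$. For a finite graph $G$, let $f(G)$ be the maximum order of an induced forest of $G$, and let $\tau(G)$ be the minimum number of vertices of $G$ whose deletion leaves a forest. A linear forest is a forest each component of which is a path. Let $n\ge 3$ and $p\ge 4$ be integers, and put $$F(p,n)=\begin{cases} p^n-\dfrac{p^{n-1}}{8}+\dfrac{p^{n-2}+p^{n-3}+\cdots+p}{8}+\dfrac{5p}{8}, & p \text{ even},\\[2mm] p^n-\dfrac{p^{n-1}+p^{n-2}-5p+3}{8}, & p\text{ odd}.\end{cases}$$ Then $\hat S_p^n$ has an induced subgraph of order exactly $F(p,n)$ that is a linear forest. Consequently $f(\hat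 S_p^n)\ge F(p,n)$ and $\tau(\hat S_p^n)\le |V(\hat S_p^n)|-F(p,n)$. -/

import Mathlib

namespace Sierpinski

/-- `EdgeAt m x y`: the words `x`, `y` have the form `x = s i j^{d-1}`, `y = s j i^{d-1}` with
`i ≠ j`, where `m` is the position right after the common prefix `s` (so `d = n - m`). -/
def EdgeAt {p n : ℕ} (m : Fin n) (x y : Fin n → Fin p) : Prop :=
  (∀ k, k < m → x k = y k) ∧ x m ≠ y m ∧ ∀ k, m < k → x k = y m ∧ y k = x m

theorem EdgeAt.symm {p n : ℕ} {m : Fin n} {x y : Fin n → Fin p} (h : EdgeAt m x y) :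
    EdgeAt m y x :=
  ⟨fun k hk => (h.1 k hk).symm, h.2.1.symm, fun k hk => ⟨(h.2.2 k hk).2, (h.2.2 k hk).1⟩⟩

/-- The Sierpiński graph `S_p^n`, on the words of length `n` over `{0, …, p - 1}`. -/
def sierpinskiGraph (p n : ℕ) : SimpleGraph (Fin n → Fin p) where
  Adj x y := ∃ m : Fin n, EdgeAt m x y
  symm := ⟨fun _ _ ⟨m, h⟩ => ⟨m, h.symm⟩⟩
  loopless := ⟨fun _ ⟨_, h⟩ => h.2.1 rfl⟩

/-- The spanning subgraph of `S_p^n` formed by the non-clique edges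
`{s i j^l, s j i^l}` with `l ≥ 1`. -/
def nonCliqueGraph (p n : ℕ) : SimpleGraph (Fin n → Fin p) where
  Adj x y := ∃ m : Fin n, (m : ℕ) + 1 < n ∧ EdgeAt m x y
  symm := ⟨fun _ _ ⟨m, hm, h⟩ => ⟨m, hm, h.symm⟩⟩
  loopless := ⟨fun _ ⟨_, _, h⟩ => h.2.1 rfl⟩

/-- The simple graph obtained from `G` by contracting all the edges of `H`: the vertices are the
connected components of `H`, and two distinct ones are adjacent if some edge of `G` joins them. -/
def contract {V : Type*} (G H : SimpleGraph V) : SimpleGraph H.ConnectedComponent where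
  Adj a b := a ≠ b ∧
    ∃ u v, G.Adj u v ∧ H.connectedComponentMk u = a ∧ H.connectedComponentMk v = b
  symm := ⟨fun _ _ ⟨hne, u, v, h, hu, hv⟩ => ⟨hne.symm, v, u, h.symm, hv, hu⟩⟩
  loopless := ⟨fun _ h => h.1 rfl⟩

/-- The vertices of the generalized Sierpiński triangle graph `Ŝ_p^n`. -/
abbrev TriangleVertex (p n : ℕ) : Type := (nonCliqueGraph p (n + 1)).ConnectedComponent

/-- The generalized Sierpiński triangle graph `Ŝ_p^n`: the Sierpiński graph `S_p^{n+1}` with all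
non-clique edges contracted. -/
def triangleGraph (p n : ℕ) : SimpleGraph (TriangleVertex p n) :=
  contract (sierpinskiGraph p (n + 1)) (nonCliqueGraph p (n + 1))

/-- A linear forest: a forest every connected component of which is a (finite) path. -/
def IsLinearForest {V : Type*} (G : SimpleGraph V) : Prop :=
  G.IsAcyclic ∧ ∀ C : G.ConnectedComponent,
    ∃ m : ℕ, Nonempty (C.toSimpleGraph ≃g SimpleGraph.pathGraph m)

/-- `f(G)`: the largest order of an induced forest of the finite graph `G`. -/
noncomputable def maxInducedForest {V : Type*} [Finite V] (G : SimpleGraph V) : ℕ :=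
  sSup {k | ∃ X : Set V, (G.induce X).IsAcyclic ∧ X.ncard = k}

/-- `τ(G)`: the least number of vertices whose deletion from the finite graph `G` leaves a
forest. -/
noncomputable def feedbackVertexNumber {V : Type*} [Finite V] (G : SimpleGraph V) : ℕ :=
  sInf {k | ∃ X : Set V, (G.induce Xᶜ).IsAcyclic ∧ X.ncard = k}

/-- The explicit order of the induced forest of `Ŝ_p^n`. -/
def forestOrder (p n : ℕ) : ℚ :=
  if Even p then
    (p : ℚ) ^ n - (p : ℚ) ^ (n - 1) / 8 + (∑ k ∈ Finset.Icc 1 (n - 2), (p : ℚ) ^ k) / 8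
      + 5 * (p : ℚ) / 8
  else
    (p : ℚ) ^ n - ((p : ℚ) ^ (n - 1) + (p : ℚ) ^ (n - 2) - 5 * (p : ℚ) + 3) / 8

end Sierpinski

/-! ### Path graphs are acyclic and connected. -/

namespace SimpleGraph

/-! A single induced path suffices. The graph `Ŝ_p^n` is a union of p^n cliques, one for each word
of length n, and a vertex lies in at most two of them because the contracted edges form a matching
(`EdgeAt.eq_of_eq`). Recursion on n gives a path that uses exactly one edge of every clique
(`exists_isCliqueTour`). A chord would place two non-consecutive path vertices in a common clique,
so the path is induced (`IsCliqueTour.triangleGraph_adj_iff`).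

The path has p^n + 1 vertices, and its initial segments are induced paths of every smaller order.
What remains is arithmetic: F(p,n) is a natural number and at most p^n + 1
(`exists_nat_eq_forestOrder`). -/

theorem isBridge_pathGraph {n : ℕ} {u v : Fin n} (h : u.val + 1 = v.val) :
    (pathGraph n).IsBridge s(u, v) := by
  rw [isBridge_iff]
  intro hr
  rw [reachable_iff_reflTransGen] at hr
  -- With the edge removed, no walk from u can pass beyond u.
  have key : ∀ w, Relation.ReflTransGen ((pathGraph n).deleteEdges {s(u, v)}).Adj u w →
      w ≤ u := by
    intro w hw
    induction hw with
    | refl => exact le_rfl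
    | @tail b c _ hbc ih =>
      rw [deleteEdges_adj, pathGraph_adj] at hbc
      obtain ⟨h1, h2⟩ := hbc
      rw [Fin.le_def] at ih ⊢
      by_contra hc
      have hb : b = u := Fin.ext (by omega)
      have hcv : c = v := Fin.ext (by omega)
      exact h2 (by simp [hb, hcv])
  have := Fin.le_def.1 (key v hr)
  omega

theorem isAcyclic_pathGraph (n : ℕ) : (pathGraph n).IsAcyclic := by
  rw [isAcyclic_iff_forall_adj_isBridge]
  intro u v h
  rcases pathGraph_adj.1 h with h | h
  · exact isBridge_pathGraph h
  · rw [Sym2.eq_swap]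
    exact isBridge_pathGraph h

/-- The only connected component of a preconnected graph is the whole graph. -/
def Preconnected.toSimpleGraphIso {V : Type*} {G : SimpleGraph V} (h : G.Preconnected)
    (C : G.ConnectedComponent) : C.toSimpleGraph ≃g G where
  toEquiv := Equiv.subtypeUnivEquiv fun v => by
    have := h.subsingleton_connectedComponent
    exact Subsingleton.elim (G.connectedComponentMk v) C
  map_rel_iff' := Iff.rfl

end SimpleGraph

namespace Sierpinski

open SimpleGraph

/-! ### From induced paths to linear forests, f and τ. -/

theorem isLinearForest_of_iso_pathGraph {V : Type*} {G : SimpleGraph V} {m : ℕ}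
    (e : G ≃g pathGraph m) : IsLinearForest G :=
  ⟨e.isAcyclic_iff.2 (isAcyclic_pathGraph m), fun C =>
    ⟨m, ⟨((e.preconnected_iff.2 (pathGraph_preconnected m)).toSimpleGraphIso C).trans e⟩⟩⟩

theorem le_maxInducedForest {V : Type*} [Finite V] {G : SimpleGraph V} {X : Set V}
    (h : (G.induce X).IsAcyclic) : X.ncard ≤ maxInducedForest G := by
  refine le_csSup ⟨Nat.card V, ?_⟩ ⟨X, h, rfl⟩
  rintro k ⟨Y, -, rfl⟩
  exact Set.ncard_le_card Y

theorem feedbackVertexNumber_add_ncard_le {V : Type*} [Finite V] {G : SimpleGraph V} {X : Set V}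
    (h : (G.induce X).IsAcyclic) : feedbackVertexNumber G + X.ncard ≤ Nat.card V := by
  have h1 : feedbackVertexNumber G ≤ Xᶜ.ncard := Nat.sInf_le ⟨Xᶜ, by rwa [compl_compl], rfl⟩
  have h2 := Set.ncard_add_ncard_compl X
  omega

/-! ### The contracted edges form a matching. -/

section Matching

variable {p n : ℕ}

/-- The position m is the last one at which x differs from its final letter, so x determines m;
exchanging the two letters then gives y. -/
theorem EdgeAt.eq_of_eq {m m' : Fin n} {x y z : Fin n → Fin p} (hm : (m : ℕ) + 1 < n)
    (hm' : (m' : ℕ) + 1 < n) (h : EdgeAt m x y) (h' : EdgeAt m' x z) : y = z := by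
  obtain ⟨h1, h2, h3⟩ := h
  obtain ⟨h1', h2', h3'⟩ := h'
  have hmm : m = m' := by
    let l : Fin n := ⟨n - 1, by omega⟩
    have hl : m < l := by rw [Fin.lt_def]; simp only [l]; omega
    have hl' : m' < l := by rw [Fin.lt_def]; simp only [l]; omega
    have e1 := (h3 l hl).1
    have e2 := (h3' l hl').1
    rcases lt_trichotomy m m' with h | h | h
    · exact absurd ((h3 m' h).1.trans (e1.symm.trans e2)) h2'
    · exact h
    · exact absurd ((h3' m h).1.trans (e2.symm.trans e1)) h2
  subst hmm
  let l : Fin n := ⟨m + 1, hm⟩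
  have hl : m < l := by rw [Fin.lt_def]; simp only [l]; omega
  funext k
  rcases lt_trichotomy k m with h | h | h
  · rw [← h1 k h, h1' k h]
  · rw [h, ← (h3 l hl).1, (h3' l hl).1]
  · rw [(h3 k h).2, (h3' k h).2]

theorem nonCliqueGraph_adj_unique {x y z : Fin n → Fin p} (h : (nonCliqueGraph p n).Adj x y)
    (h' : (nonCliqueGraph p n).Adj x z) : y = z := by
  obtain ⟨m, hm, h⟩ := h
  obtain ⟨m', hm', h'⟩ := h'
  exact h.eq_of_eq hm hm' h'

theorem not_nonCliqueGraph_adj_const {i : Fin p} {y : Fin n → Fin p} :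
    ¬ (nonCliqueGraph p n).Adj (fun _ => i) y := by
  rintro ⟨m, hm, h1, h2, h3⟩
  exact h2 (h3 ⟨m + 1, hm⟩ (by simp [Fin.lt_def])).1

/-- The non-clique edges form a matching, so components have at most two elements. -/
theorem nonCliqueGraph_mk_eq {x y : Fin n → Fin p}
    (h : (nonCliqueGraph p n).connectedComponentMk x = (nonCliqueGraph p n).connectedComponentMk y) :
    y = x ∨ (nonCliqueGraph p n).Adj x y := by
  have hr := ConnectedComponent.exact h
  rw [reachable_iff_reflTransGen] at hr
  induction hr with
  | refl => exact Or.inl rfl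
  | @tail b c hb hbc ih =>
    rcases ih (ConnectedComponent.sound ((reachable_iff_reflTransGen _ _).2 hb)) with rfl | ih
    · exact Or.inr hbc
    · exact Or.inl (nonCliqueGraph_adj_unique hbc ih.symm)

end Matching

/-! ### Cliques, and prefixing a letter. -/

/-- Two words of length `n + 1` lie in the same clique: they agree except possibly in the last
letter. -/
def SameClique {p n : ℕ} (x y : Fin (n + 1) → Fin p) : Prop :=
  ∀ m : Fin (n + 1), (m : ℕ) < n → x m = y m

namespace SameClique

variable {p n : ℕ} {x y z : Fin (n + 1) → Fin p}

theorem refl (x : Fin (n + 1) → Fin p) : SameClique x x := fun _ _ => rfl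

theorem symm (h : SameClique x y) : SameClique y x := fun m hm => (h m hm).symm

theorem trans (h : SameClique x y) (h' : SameClique y z) : SameClique x z :=
  fun m hm => (h m hm).trans (h' m hm)

theorem cons_iff {c d : Fin p} :
    SameClique (Fin.cons c x : Fin (n + 2) → Fin p) (Fin.cons d y : Fin (n + 2) → Fin p) ↔
      c = d ∧ SameClique x y := by
  constructor
  · intro h
    exact ⟨by simpa using h 0 (by simp), fun m hm => by
      simpa using h m.succ (by simpa using hm)⟩
  · rintro ⟨rfl, h⟩ m
    refine Fin.cases (fun _ => by simp) (fun m hm => ?_) m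
    simpa using h m (by simpa using hm)

theorem sierpinskiGraph_adj (h : SameClique x y) (hne : x ≠ y) :
    (sierpinskiGraph p (n + 1)).Adj x y := by
  have hlt : ∀ k : Fin (n + 1), k ≠ Fin.last n → (k : ℕ) < n := fun k hk => by
    have := Fin.val_lt_last hk
    simpa using this
  refine ⟨Fin.last n, fun k hk => h k (hlt k hk.ne), fun he => hne (funext fun k => ?_),
    fun k hk => absurd hk (Fin.le_last k).not_gt⟩
  by_cases hk : k = Fin.last n
  · rw [hk, he]
  · exact h k (hlt k hk)

end SameClique

theorem EdgeAt.sameClique {p n : ℕ} {m : Fin (n + 1)} {x y : Fin (n + 1) → Fin p}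
    (h : EdgeAt m x y) (hm : (m : ℕ) = n) : SameClique x y :=
  fun k hk => h.1 k (by rw [Fin.lt_def]; omega)

theorem nonCliqueGraph_adj_cons {p n : ℕ} {x y : Fin n → Fin p} (c : Fin p)
    (h : (nonCliqueGraph p n).Adj x y) :
    (nonCliqueGraph p (n + 1)).Adj (Fin.cons c x) (Fin.cons c y) := by
  obtain ⟨m, hm, h1, h2, h3⟩ := h
  refine ⟨m.succ, by simpa using hm, fun k => ?_, by simpa using h2, fun k => ?_⟩
  · refine Fin.cases (fun _ => by simp) (fun k hk => ?_) k
    simpa using h1 k (by simpa using hk)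
  · refine Fin.cases (fun hk => absurd hk (by simp)) (fun k hk => ?_) k
    simpa using h3 k (by simpa using hk)

theorem nonCliqueGraph_adj_cons_const {p n : ℕ} {c d : Fin p} (h : c ≠ d) :
    (nonCliqueGraph p (n + 2)).Adj (Fin.cons c fun _ => d) (Fin.cons d fun _ => c) := by
  refine ⟨0, by simp, fun k hk => absurd hk (by simp), by simpa using h, fun k => ?_⟩
  refine Fin.cases (fun hk => absurd hk (by simp)) (fun k _ => by simp) k

/-! ### Recursive construction of a tour of all cliques. -/

theorem exists_enumeration {p : ℕ} (hp : 2 ≤ p) {i j : Fin p} (hij : i ≠ j) :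
    ∃ σ : ℕ → Fin p, Set.InjOn σ (Set.Iio p) ∧ σ 0 = i ∧ σ (p - 1) = j := by
  let a : Fin p := ⟨0, by omega⟩
  let b : Fin p := ⟨p - 1, by omega⟩
  have hab : a ≠ b := by simp [a, b, Fin.ext_iff]; omega
  -- The inner swap sends a to i; the outer one corrects the image of b to j and fixes i.
  let e : Equiv.Perm (Fin p) := Equiv.swap (Equiv.swap a i b) j * Equiv.swap a i
  have hb : i ≠ Equiv.swap a i b := fun h => hab (by
    have : Equiv.swap a i a = Equiv.swap a i b := by rw [Equiv.swap_apply_left]; exact h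
    exact (Equiv.swap a i).injective this)
  refine ⟨fun k => if h : k < p then e ⟨k, h⟩ else i, ?_, ?_, ?_⟩
  · intro k hk l hl h
    have hk' : k < p := hk
    have hl' : l < p := hl
    simpa [hk', hl', Fin.ext_iff] using h
  · have : 0 < p := by omega
    simp only [this, dite_true]
    change Equiv.swap _ j (Equiv.swap a i a) = i
    rw [Equiv.swap_apply_left, Equiv.swap_apply_of_ne_of_ne hb hij]
  · have : p - 1 < p := by omega
    simp only [this, dite_true]
    change Equiv.swap _ j (Equiv.swap a i b) = j
    rw [Equiv.swap_apply_left]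

/-- A path through all the cliques of `S_p^{n+1}` from the extreme vertex `i^{n+1}` to `j^{n+1}`:
the `k`-th clique is entered at `x k` and left at `y k`. -/
structure IsCliqueTour (p n : ℕ) (i j : Fin p) (x y : ℕ → Fin (n + 1) → Fin p) : Prop where
  sameClique : ∀ k < p ^ n, SameClique (x k) (y k)
  ne : ∀ k < p ^ n, x k ≠ y k
  adj : ∀ k, k + 1 < p ^ n → (nonCliqueGraph p (n + 1)).Adj (y k) (x (k + 1))
  inj : ∀ k < p ^ n, ∀ l < p ^ n, SameClique (x k) (x l) → k = l
  start : x 0 = fun _ => i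
  finish : y (p ^ n - 1) = fun _ => j

theorem isCliqueTour_zero {p : ℕ} {i j : Fin p} (hij : i ≠ j) :
    IsCliqueTour p 0 i j (fun _ _ => i) (fun _ _ => j) where
  sameClique _ _ m hm := absurd hm (by simp)
  ne _ _ h := hij (congrFun h 0)
  adj k hk := absurd hk (by simp)
  inj k hk l hl _ := by simp at hk hl; omega
  start := rfl
  finish := rfl

/-- The copies are visited in the order σ 0, …, σ (p - 1), and copy q is crossed from its corner σ
(q - 1) to its corner σ (q + 1). Truncated subtraction and `min` make the first entrance and the
last exit the outer corners. Clique k is number k % p^n of copy k / p^n. -/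
theorem IsCliqueTour.cons {p n : ℕ} (hp : 0 < p) {σ : ℕ → Fin p} (hσ : Set.InjOn σ (Set.Iio p))
    {x y : ℕ → ℕ → Fin (n + 1) → Fin p}
    (h : ∀ q < p, IsCliqueTour p n (σ (q - 1)) (σ (min (q + 1) (p - 1))) (x q) (y q)) :
    IsCliqueTour p (n + 1) (σ 0) (σ (p - 1))
      (fun k => Fin.cons (σ (k / p ^ n)) (x (k / p ^ n) (k % p ^ n)))
      (fun k => Fin.cons (σ (k / p ^ n)) (y (k / p ^ n) (k % p ^ n))) := by
  have hN : 0 < p ^ n := pow_pos hp n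
  have hq : ∀ k < p ^ (n + 1), k / p ^ n < p := fun k hk =>
    Nat.div_lt_of_lt_mul (by rwa [pow_succ] at hk)
  have hr : ∀ k, k % p ^ n < p ^ n := fun k => Nat.mod_lt k hN
  refine ⟨fun k hk => ?_, fun k hk he => ?_, fun k hk => ?_, fun k hk l hl hkl => ?_, ?_, ?_⟩
  · exact SameClique.cons_iff.2 ⟨rfl, (h _ (hq k hk)).sameClique _ (hr k)⟩
  · exact (h _ (hq k hk)).ne _ (hr k) (Fin.cons_right_injective _ he)
  · have hdm := Nat.div_add_mod k (p ^ n)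
    have hrk := hr k
    by_cases hlt : k % p ^ n + 1 < p ^ n
    · have hk1 : k + 1 = p ^ n * (k / p ^ n) + (k % p ^ n + 1) := by omega
      have e1 : (k + 1) / p ^ n = k / p ^ n := by
        conv_lhs => rw [hk1]
        rw [Nat.mul_add_div hN, Nat.div_eq_of_lt hlt, add_zero]
      have e2 : (k + 1) % p ^ n = k % p ^ n + 1 := by
        conv_lhs => rw [hk1]
        rw [Nat.mul_add_mod, Nat.mod_eq_of_lt hlt]
      simp only [e1, e2]
      exact nonCliqueGraph_adj_cons _ ((h _ (hq k (by omega))).adj _ hlt)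
    -- Passage to the next copy: the exit corner is matched with the next entrance corner.
    · have hk1 : k + 1 = p ^ n * (k / p ^ n + 1) := by rw [mul_add]; omega
      have e1 : (k + 1) / p ^ n = k / p ^ n + 1 := by
        rw [hk1, Nat.mul_div_cancel_left _ hN]
      have e2 : (k + 1) % p ^ n = 0 := by
        rw [hk1, Nat.mul_mod_right]
      have e3 : k % p ^ n = p ^ n - 1 := by omega
      have hq1 := hq _ hk
      rw [e1] at hq1
      have hmin : min (k / p ^ n + 1) (p - 1) = k / p ^ n + 1 := by omega
      simp only [e1, e2, e3]
      rw [(h _ (by omega)).finish, (h _ hq1).start, Nat.add_sub_cancel, hmin]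
      refine nonCliqueGraph_adj_cons_const fun he => ?_
      have := hσ (Set.mem_Iio.2 (by omega)) (Set.mem_Iio.2 hq1) he
      omega
  · obtain ⟨h1, h2⟩ := SameClique.cons_iff.1 hkl
    have e := hσ (Set.mem_Iio.2 (hq k hk)) (Set.mem_Iio.2 (hq l hl)) h1
    rw [← e] at h2
    have e' := (h _ (hq k hk)).inj _ (hr k) _ (hr l) h2
    rw [← Nat.div_add_mod k (p ^ n), ← Nat.div_add_mod l (p ^ n), e, e']
  · simp only [Nat.zero_div, Nat.zero_mod]
    rw [(h 0 hp).start]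
    funext m
    refine Fin.cases ?_ (fun m => ?_) m <;> simp
  · have hk1 : p ^ (n + 1) - 1 = p ^ n * (p - 1) + (p ^ n - 1) := by
      obtain ⟨q, rfl⟩ : ∃ q, p = q + 1 := ⟨p - 1, by omega⟩
      rw [pow_succ, mul_add, Nat.add_sub_cancel]
      omega
    have e1 : (p ^ (n + 1) - 1) / p ^ n = p - 1 := by
      rw [hk1, Nat.mul_add_div hN, Nat.div_eq_of_lt (by omega), add_zero]
    have e2 : (p ^ (n + 1) - 1) % p ^ n = p ^ n - 1 := by
      rw [hk1, Nat.mul_add_mod, Nat.mod_eq_of_lt (by omega)]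
    simp only [e1, e2]
    rw [(h _ (by omega)).finish]
    funext m
    refine Fin.cases ?_ (fun m => ?_) m <;> simp

theorem exists_isCliqueTour {p : ℕ} (hp : 3 ≤ p) (n : ℕ) {i j : Fin p} (hij : i ≠ j) :
    ∃ x y, IsCliqueTour p n i j x y := by
  induction n generalizing i j with
  | zero => exact ⟨_, _, isCliqueTour_zero hij⟩
  | succ n ih =>
    obtain ⟨σ, hσ, rfl, rfl⟩ := exists_enumeration (by omega) hij
    have : ∀ q, ∃ x y, q < p →
        IsCliqueTour p n (σ (q - 1)) (σ (min (q + 1) (p - 1))) x y := by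
      intro q
      by_cases hq : q < p
      · obtain ⟨x, y, h⟩ := ih (i := σ (q - 1)) (j := σ (min (q + 1) (p - 1))) fun he => by
          have := hσ (Set.mem_Iio.2 (by omega)) (Set.mem_Iio.2 (by omega)) he
          omega
        exact ⟨x, y, fun _ => h⟩
      · exact ⟨fun _ _ => σ 0, fun _ _ => σ 0, fun h => absurd h hq⟩
    choose x y h using this
    exact ⟨_, _, IsCliqueTour.cons (by omega) hσ h⟩

/-! ### The tour induces a path. -/

/-- The vertices of `Ŝ_p^n` visited by a tour of the cliques. -/
def tourVertex {p n : ℕ} (x y : ℕ → Fin (n + 1) → Fin p) : ℕ → TriangleVertex p n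
  | 0 => (nonCliqueGraph p (n + 1)).connectedComponentMk (x 0)
  | k + 1 => (nonCliqueGraph p (n + 1)).connectedComponentMk (y k)

namespace IsCliqueTour

variable {p n : ℕ} {i j : Fin p} {x y : ℕ → Fin (n + 1) → Fin p}

theorem tourVertex_of_lt (h : IsCliqueTour p n i j x y) {k : ℕ} (hk : k < p ^ n) :
    tourVertex x y k = (nonCliqueGraph p (n + 1)).connectedComponentMk (x k) := by
  cases k with
  | zero => rfl
  | succ k => exact ConnectedComponent.sound (h.adj k hk).reachable

/-- An inner tour vertex consists of the exit of one clique and the entrance of the next; the two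
ends are constant words, which are unmatched. -/
theorem eq_or_eq_of_mk_eq (h : IsCliqueTour p n i j x y) {k : ℕ} (hk : k ≤ p ^ n)
    {z : Fin (n + 1) → Fin p}
    (hz : (nonCliqueGraph p (n + 1)).connectedComponentMk z = tourVertex x y k) :
    (k < p ^ n ∧ z = x k) ∨ (1 ≤ k ∧ z = y (k - 1)) := by
  cases k with
  | zero =>
    rcases nonCliqueGraph_mk_eq hz.symm with hz | hz
    · exact Or.inl ⟨pow_pos i.pos n, hz⟩
    · rw [h.start] at hz
      exact absurd hz not_nonCliqueGraph_adj_const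
  | succ k =>
    rcases nonCliqueGraph_mk_eq hz.symm with hz | hz
    · exact Or.inr ⟨by omega, hz⟩
    · rcases hk.lt_or_eq with hk | hk
      · exact Or.inl ⟨hk, nonCliqueGraph_adj_unique hz (h.adj k hk)⟩
      · have e : k = p ^ n - 1 := by omega
        rw [e, h.finish] at hz
        exact absurd hz not_nonCliqueGraph_adj_const

theorem exists_sameClique (h : IsCliqueTour p n i j x y) {k : ℕ} (hk : k ≤ p ^ n)
    {z : Fin (n + 1) → Fin p}
    (hz : (nonCliqueGraph p (n + 1)).connectedComponentMk z = tourVertex x y k) :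
    ∃ l < p ^ n, (k = l ∨ k = l + 1) ∧ SameClique z (x l) := by
  rcases h.eq_or_eq_of_mk_eq hk hz with ⟨hk', rfl⟩ | ⟨hk', rfl⟩
  · exact ⟨k, hk', Or.inl rfl, SameClique.refl _⟩
  · exact ⟨k - 1, by omega, Or.inr (by omega), (h.sameClique _ (by omega)).symm⟩

theorem tourVertex_ne_of_lt (h : IsCliqueTour p n i j x y) {k l : ℕ} (hkl : k < l)
    (hl : l ≤ p ^ n) : tourVertex x y k ≠ tourVertex x y l := by
  intro he
  rw [h.tourVertex_of_lt (by omega)] at he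
  rcases h.eq_or_eq_of_mk_eq hl he with ⟨hl', e⟩ | ⟨hl', e⟩
  · have := h.inj k (by omega) l hl' (e ▸ SameClique.refl _)
    omega
  · have hs := (h.sameClique (l - 1) (by omega)).symm
    rw [← e] at hs
    have := h.inj k (by omega) (l - 1) (by omega) hs
    exact h.ne k (by omega) (by rw [e, this])

theorem tourVertex_inj (h : IsCliqueTour p n i j x y) {k l : ℕ} (hk : k ≤ p ^ n)
    (hl : l ≤ p ^ n) (he : tourVertex x y k = tourVertex x y l) : k = l := by
  rcases lt_trichotomy k l with hkl | hkl | hkl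
  · exact absurd he (h.tourVertex_ne_of_lt hkl hl)
  · exact hkl
  · exact absurd he.symm (h.tourVertex_ne_of_lt hkl hk)

theorem triangleGraph_adj_succ (h : IsCliqueTour p n i j x y) {k : ℕ} (hk : k < p ^ n) :
    (triangleGraph p n).Adj (tourVertex x y k) (tourVertex x y (k + 1)) :=
  ⟨h.tourVertex_ne_of_lt (by omega) hk, x k, y k,
    (h.sameClique k hk).sierpinskiGraph_adj (h.ne k hk), (h.tourVertex_of_lt hk).symm, rfl⟩

theorem triangleGraph_adj_iff (h : IsCliqueTour p n i j x y) {k l : ℕ} (hk : k ≤ p ^ n)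
    (hl : l ≤ p ^ n) : (triangleGraph p n).Adj (tourVertex x y k) (tourVertex x y l) ↔
      k + 1 = l ∨ l + 1 = k := by
  constructor
  · rintro ⟨hne, u, v, ⟨m, hm⟩, hu, hv⟩
    -- A non-clique edge would be contracted, making the two vertices equal.
    have hmn : (m : ℕ) = n := by
      by_contra hmn
      refine hne (hu ▸ hv ▸ ConnectedComponent.sound (Adj.reachable ⟨m, ?_, hm⟩))
      omega
    have huv := hm.sameClique hmn
    obtain ⟨a, ha, hka, hua⟩ := h.exists_sameClique hk hu
    obtain ⟨b, hb, hlb, hvb⟩ := h.exists_sameClique hl hv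
    -- Both vertices touch the same clique a, so k and l lie in {a, a + 1}.
    have hab := h.inj a ha b hb (hua.symm.trans (huv.trans hvb))
    have : k ≠ l := fun e => hne (by rw [e])
    omega
  · rintro (rfl | rfl)
    · exact h.triangleGraph_adj_succ hl
    · exact (h.triangleGraph_adj_succ hk).symm

/-- The first `m` vertices of a tour induce a path. -/
def pathEmbedding (h : IsCliqueTour p n i j x y) {m : ℕ} (hm : m ≤ p ^ n + 1) :
    pathGraph m ↪g triangleGraph p n where
  toFun k := tourVertex x y k
  inj' k l he := Fin.ext (h.tourVertex_inj (by omega) (by omega) he)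
  map_rel_iff' {k l} := by
    rw [pathGraph_adj]
    exact h.triangleGraph_adj_iff (by omega) (by omega)

end IsCliqueTour

theorem exists_isLinearForest {p n m : ℕ} (hp : 3 ≤ p) (hm : m ≤ p ^ n + 1) :
    ∃ X : Set (TriangleVertex p n),
      IsLinearForest ((triangleGraph p n).induce X) ∧ X.ncard = m := by
  obtain ⟨x, y, h⟩ := exists_isCliqueTour hp n
    (i := ⟨0, by omega⟩) (j := ⟨1, by omega⟩) (by simp)
  let f := h.pathEmbedding hm
  refine ⟨Set.range f, isLinearForest_of_iso_pathGraph (m := m) ?_, ?_⟩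
  · exact (f.isoInduceRange).symm
  · rw [← Set.image_univ, Set.ncard_image_of_injective _ f.injective, Set.ncard_univ,
      Nat.card_eq_fintype_card, Fintype.card_fin]

/-! ### Integrality and size of F(p,n). -/

/-- Here t = p^n - F(p,n) with n = m + 3. Raising m by one adds p^(m+2) (p - 2) to the left side, a
nonnegative multiple of 8. The bound -1 is attained at p = 4, m = 0, where the whole tour is needed.
-/
theorem forestDefect_even {p : ℤ} (hp : 4 ≤ p) (he : Even p) (m : ℕ) :
    ∃ t : ℤ, p ^ (m + 2) - ∑ k ∈ Finset.Icc 1 (m + 1), p ^ k - 5 * p = 8 * t ∧ -1 ≤ t := by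
  obtain ⟨q, rfl⟩ := he
  induction m with
  | zero =>
    obtain ⟨r, hr⟩ : Even (q * (q + 1)) := Int.even_mul_succ_self q
    refine ⟨r - 2 * q, ?_, ?_⟩
    · simp only [zero_add, Finset.Icc_self, Finset.sum_singleton]
      linear_combination 4 * hr
    · nlinarith
  | succ m ih =>
    obtain ⟨t, ht, ht'⟩ := ih
    refine ⟨t + (q + q) ^ m * (q ^ 2 * (q - 1)), ?_, ?_⟩
    · rw [Finset.sum_Icc_succ_top (by omega)]
      linear_combination ht
    · have : 0 ≤ (q + q) ^ m * (q ^ 2 * (q - 1)) :=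
        mul_nonneg (pow_nonneg (by omega) _) (mul_nonneg (sq_nonneg q) (by omega))
      omega

/-- Raising m by one adds p^(m+1) (p^2 - 1), and 8 divides p^2 - 1 = 4q(q + 1). -/
theorem forestDefect_odd {p : ℤ} (hp : 4 ≤ p) (ho : Odd p) (m : ℕ) :
    ∃ t : ℤ, p ^ (m + 2) + p ^ (m + 1) - 5 * p + 3 = 8 * t ∧ -1 ≤ t := by
  obtain ⟨q, rfl⟩ := ho
  obtain ⟨r, hr⟩ : Even (q * (q + 1)) := Int.even_mul_succ_self q
  have hq : 2 ≤ q := by omega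
  induction m with
  | zero =>
    refine ⟨r - q, ?_, ?_⟩
    · linear_combination 4 * hr
    · nlinarith
  | succ m ih =>
    obtain ⟨t, ht, ht'⟩ := ih
    refine ⟨t + (2 * q + 1) ^ (m + 1) * r, ?_, ?_⟩
    · linear_combination ht + 4 * (2 * q + 1) ^ (m + 1) * hr
    · have : 0 ≤ (2 * q + 1) ^ (m + 1) * r :=
        mul_nonneg (pow_nonneg (by omega) _) (by nlinarith)
      omega

theorem exists_nat_eq_forestOrder {n p : ℕ} (hn : 3 ≤ n) (hp : 4 ≤ p) :
    ∃ m : ℕ, (m : ℚ) = forestOrder p n ∧ m ≤ p ^ n + 1 := by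
  obtain ⟨k, rfl⟩ : ∃ k, n = k + 3 := ⟨n - 3, by omega⟩
  have hp' : (4 : ℤ) ≤ p := by exact_mod_cast hp
  -- The lower bound on t gives F ≤ p^n + 1; the upper bound only ensures F ≥ 0.
  suffices H : ∃ t : ℤ, ((p : ℤ) ^ (k + 3) - t : ℤ) = forestOrder p (k + 3) ∧ -1 ≤ t ∧
      8 * t ≤ (p : ℤ) ^ (k + 2) + (p : ℤ) ^ (k + 1) by
    obtain ⟨t, h1, h2, h3⟩ := H
    have hpos : 0 ≤ (p : ℤ) ^ (k + 3) - t := by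
      have e1 : (p : ℤ) ^ (k + 1) ≤ (p : ℤ) ^ (k + 3) :=
        pow_le_pow_right₀ (by omega) (by omega)
      have e2 : (p : ℤ) ^ (k + 2) ≤ (p : ℤ) ^ (k + 3) :=
        pow_le_pow_right₀ (by omega) (by omega)
      have e3 : 0 ≤ (p : ℤ) ^ (k + 3) := by positivity
      omega
    obtain ⟨m, hm⟩ := Int.eq_ofNat_of_zero_le hpos
    refine ⟨m, ?_, ?_⟩
    · rw [← h1, hm]
      simp
    · zify
      omega
  have hk1 : 0 ≤ (p : ℤ) ^ (k + 1) := by positivity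
  rcases Nat.even_or_odd p with he | ho
  · obtain ⟨t, ht, ht'⟩ := forestDefect_even hp' (by exact_mod_cast he) k
    refine ⟨t, ?_, ht', ?_⟩
    · have hq := congrArg (Int.cast : ℤ → ℚ) ht
      push_cast at hq ⊢
      simp only [forestOrder, he, if_true,
        show k + 3 - 1 = k + 2 by omega, show k + 3 - 2 = k + 1 by omega]
      linear_combination hq / 8
    · have : 0 ≤ ∑ l ∈ Finset.Icc 1 (k + 1), (p : ℤ) ^ l :=
        Finset.sum_nonneg fun _ _ => by positivity
      omega
  · obtain ⟨t, ht, ht'⟩ := forestDefect_odd hp' (by exact_mod_cast ho) k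
    refine ⟨t, ?_, ht', ?_⟩
    · have hq := congrArg (Int.cast : ℤ → ℚ) ht
      push_cast at hq ⊢
      simp only [forestOrder, Nat.not_even_iff_odd.2 ho, if_false,
        show k + 3 - 1 = k + 2 by omega, show k + 3 - 2 = k + 1 by omega]
      linear_combination hq / 8
    · omega

end Sierpinski

theorem theorem4p1 (n p : ℕ) (hn : 3 ≤ n) (hp : 4 ≤ p) :
    (∃ X : Set (Sierpinski.TriangleVertex p n),
      Sierpinski.IsLinearForest ((Sierpinski.triangleGraph p n).induce X) ∧
      (X.ncard : ℚ) = Sierpinski.forestOrder p n) ∧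
    Sierpinski.forestOrder p n ≤
      (Sierpinski.maxInducedForest (Sierpinski.triangleGraph p n) : ℚ) ∧
    (Sierpinski.feedbackVertexNumber (Sierpinski.triangleGraph p n) : ℚ) ≤
      (Nat.card (Sierpinski.TriangleVertex p n) : ℚ) - Sierpinski.forestOrder p n := by
  obtain ⟨m, hm, hle⟩ := Sierpinski.exists_nat_eq_forestOrder hn hp
  obtain ⟨X, hX, hcard⟩ := Sierpinski.exists_isLinearForest (by omega) hle
  rw [← hm, ← hcard]
  refine ⟨⟨X, hX, rfl⟩, ?_, ?_⟩
  · exact_mod_cast Sierpinski.le_maxInducedForest hX.1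
  · rw [le_sub_iff_add_le]
    exact_mod_cast Sierpinski.feedbackVertexNumber_add_ncard_le hX.1
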